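/- Let $g$ be the entire function $g(z)=\sum_{n\ge 0}\frac{z^n}{(2n+1)!}$, i.e. $g(z)=\sinh(\sqrt z)/\sqrt z$ for $z\neq 0$ (either value of $\sqrt z$) and $g(0)=1$. The equation $\tan\eta=\eta$ has a least positive real root $\eta_1$; put $\omega_1=\sin(\eta_1)/\eta_1$. Then $|\omega_1+0.217|<0.0005$ (so $1-\omega_1\approx 1.217$). Let $B=\{\omega\in\mathbb C: |\omega-1|<1-\omega_1\}$. There is a function $h$, analytic on $B$, with $h(1)=0$ and $g(h(\omega))=\omega$ for all $\omega\in B$, and such that: 1. The Taylor series of $h$ at $1$ converges to $h(\omega)$ for every $\omega\in B$, and its radius of convergence is exactly $1-\omega_1$. 2. The point $\omega_1\in\partial B$ is a square-root branch point of $h$: there are $\varepsilon>0$ and a function $\psi$, analytic on the open disc of radius $\sqrt\varepsilon$ centred at $0$, with $\psi(0)=-\eta_1^2$ and $\psi'(0)\neq 0$, such that $h(\omega)=\psi\big((\omega-\omega_1)^{1/2}\big)$ (principal square root) for all $\omega\in B$ with $|\omega-\omega_1|<\varepsilon$. 3. $h$ has no analytic extension to $\omega_1$: there is no function analytic in a neighbourhood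 of $\omega_1$ that agrees with $h$ at all points of $B$ sufficiently close to $\omega_1$. -/

import Mathlib

/-- The entire function `g(z) = ∑ zⁿ / (2n+1)!`. -/
noncomputable def gFun (z : ℂ) : ℂ :=
  ∑' n : ℕ, z ^ n / (((2 * n + 1).factorial : ℕ) : ℂ)

/-- The defining series converges at every complex number. -/
theorem gFun_hasSum (z : ℂ) :
    HasSum (fun n : ℕ => z ^ n / (((2 * n + 1).factorial : ℕ) : ℂ)) (gFun z) := by
  refine Summable.hasSum (Summable.of_norm_bounded (Real.summable_pow_div_factorial ‖z‖) ?_)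
  intro n
  rw [norm_div, norm_pow, Complex.norm_natCast]
  gcongr
  omega

/-- `g(z) = sinh(√z)/√z`, for either choice of the square root `ξ` of `z ≠ 0`. -/
theorem gFun_sq (ξ : ℂ) (hξ : ξ ≠ 0) : gFun (ξ ^ 2) = Complex.sinh ξ / ξ := by
  refine (gFun_hasSum (ξ ^ 2)).unique ?_
  refine ((Complex.hasSum_sinh ξ).div_const ξ).congr_fun ?_
  intro n
  field_simp
  ring

/-- `η₁`, the first positive root of `tan η = η`. -/
noncomputable def eta1 : ℝ := sInf {η : ℝ | 0 < η ∧ Real.tan η = η}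

/-- `ω₁ = sin(η₁)/η₁`. -/
noncomputable def omega1 : ℝ := Real.sin eta1 / eta1

/-- The `n`-th Taylor coefficient of `h` at the point `a`. -/
noncomputable def taylorCoeffAt (h : ℂ → ℂ) (a : ℂ) (n : ℕ) : ℂ :=
  iteratedDeriv n h a / (n.factorial : ℂ)

open Filter Topology Set

/-! On the real axis `g` increases on `[-η₁², 0]` from `ω₁` to `1`: with `x = -y²`, `2y³g'(x) = sin
y - y cos y`, which first vanishes at `y = η₁`. So `s ↦ 1 - g(-s)` has a real-analytic inverse `k`
on `[0, 1 - ω₁)`, and the candidate is `h(ω) = -k(1 - ω)`. The difficulty is that `h` might be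
singular elsewhere in the disc.

This is excluded by positivity. The equation `4zg'' + 6g' = g`, differentiated once, gives a Riccati
equation for `u(s) = g''(-s)/g'(-s)` whose recursion forces nonnegative Taylor coefficients at `0`.
They pass to `F(s) = 1/g'(-s)`, since `F' = uF`, and to `k`, since `k' = F ∘ k`. As in Pringsheim's
theorem, a series with nonnegative coefficients converges as far as its sum continues analytically
along the positive axis, here up to `1 - ω₁` (`le_radius_of_iteratedDeriv_nonneg`). The identity
theorem then gives `g ∘ h = id` on the whole disc.

At `-η₁²` one has `g' = 0` and `g'' > 0`, so `g - ω₁` is the square of a local coordinate; inverting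
that coordinate gives `ψ`. An analytic extension of `h` to `ω₁` would contradict the chain rule for
`g ∘ h = id`, so the radius is exactly `1 - ω₁`. -/

/-! ### Nonnegative derivatives from differential equations -/

theorem iteratedDeriv_mul_nonneg {f g : ℝ → ℝ} {x : ℝ} {n : ℕ} (hf : AnalyticAt ℝ f x)
    (hg : AnalyticAt ℝ g x) (hf0 : ∀ i ≤ n, 0 ≤ iteratedDeriv i f x)
    (hg0 : ∀ i ≤ n, 0 ≤ iteratedDeriv i g x) : 0 ≤ iteratedDeriv n (f * g) x := by
  rw [iteratedDeriv_mul hf.contDiffAt hg.contDiffAt]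
  refine Finset.sum_nonneg fun i hi => ?_
  have hi' : i ≤ n := Nat.lt_succ_iff.1 (Finset.mem_range.1 hi)
  have h1 := hf0 i hi'
  have h2 := hg0 (n - i) (Nat.sub_le _ _)
  positivity

/-- If `f' = w f` and `f`, `w` are nonnegative at `x` together with all derivatives of `w`, then all
derivatives of `f` at `x` are nonnegative. -/
theorem iteratedDeriv_nonneg_of_deriv_eq_mul {f w : ℝ → ℝ} {x : ℝ} (hf : AnalyticAt ℝ f x)
    (hw : AnalyticAt ℝ w x) (h : deriv f =ᶠ[𝓝 x] w * f) (hf0 : 0 ≤ f x)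
    (hw0 : ∀ n, 0 ≤ iteratedDeriv n w x) (n : ℕ) : 0 ≤ iteratedDeriv n f x := by
  induction n using Nat.strong_induction_on with
  | _ n ih =>
    cases n with
    | zero => simpa using hf0
    | succ n =>
      rw [iteratedDeriv_succ', h.iteratedDeriv_eq]
      exact iteratedDeriv_mul_nonneg hw hf (fun i _ => hw0 i)
        (fun i hi => ih i (Nat.lt_succ_of_le hi))

/-- A sequence of functions with `φ j ' = φ (j + 1) * φ 0` and nonnegative values at `x` has
nonnegative derivatives at `x`. -/
theorem iteratedDeriv_nonneg_of_deriv_eq_succ_mul_zero {φ : ℕ → ℝ → ℝ} {x : ℝ}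
    (hφ : ∀ j, AnalyticAt ℝ (φ j) x) (h : ∀ j, deriv (φ j) =ᶠ[𝓝 x] φ (j + 1) * φ 0)
    (h0 : ∀ j, 0 ≤ φ j x) (n j : ℕ) : 0 ≤ iteratedDeriv n (φ j) x := by
  induction n using Nat.strong_induction_on generalizing j with
  | _ n ih =>
    cases n with
    | zero => simpa using h0 j
    | succ n =>
      rw [iteratedDeriv_succ', (h j).iteratedDeriv_eq]
      exact iteratedDeriv_mul_nonneg (hφ _) (hφ _) (fun i hi => ih i (Nat.lt_succ_of_le hi) _)
        (fun i hi => ih i (Nat.lt_succ_of_le hi) _)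

/-- If `k' = F ∘ k` with `k 0 = 0` and `F` has nonnegative derivatives at `0`, so does `k`. -/
theorem iteratedDeriv_nonneg_of_deriv_eq_comp {F k : ℝ → ℝ} (hF : AnalyticAt ℝ F 0)
    (hk : AnalyticAt ℝ k 0) (hk0 : k 0 = 0) (h : deriv k =ᶠ[𝓝 0] F ∘ k)
    (hF0 : ∀ n, 0 ≤ iteratedDeriv n F 0) (n : ℕ) : 0 ≤ iteratedDeriv n k 0 := by
  cases n with
  | zero => simp [hk0]
  | succ n =>
    rw [iteratedDeriv_succ', h.iteratedDeriv_eq]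
    have hFj : ∀ j, AnalyticAt ℝ (iteratedDeriv j F) (k 0) := fun j => by
      rw [hk0, iteratedDeriv_eq_iterate]; exact hF.iterated_deriv j
    -- With `φ j = F⁽ʲ⁾ ∘ k`, the chain rule and `k' = φ 0` give `(φ j)' = φ (j + 1) * φ 0`.
    have key := iteratedDeriv_nonneg_of_deriv_eq_succ_mul_zero
      (φ := fun j => iteratedDeriv j F ∘ k) (x := 0) (fun j => (hFj j).comp hk) ?_ ?_ n 0
    · simpa using key
    · intro j
      have e1 := hk.continuousAt.eventually (hFj j).eventually_analyticAt
      filter_upwards [e1, hk.eventually_analyticAt, h] with t h1 h2 h3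
      have := h1.differentiableAt.hasDerivAt.comp t h2.differentiableAt.hasDerivAt
      rw [this.deriv, iteratedDeriv_succ, h3]
      simp
    · intro j
      simpa [hk0] using hF0 j

/-- In the Leibniz sum at `0` only the term differentiating `s` exactly once survives. -/
theorem iteratedDeriv_succ_id_mul_zero {w : ℝ → ℝ} (hw : AnalyticAt ℝ w 0) (n : ℕ) :
    iteratedDeriv (n + 1) (fun s => s * w s) 0 = (n + 1) * iteratedDeriv n w 0 := by
  have h := iteratedDeriv_fun_mul (n := n + 1) (f := fun s : ℝ => s) (g := w) (x := 0)
    analyticAt_id.contDiffAt hw.contDiffAt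
  rw [h, Finset.sum_eq_single 1]
  · simp
  · intro i _ hi
    simp [iteratedDeriv_fun_id_zero, hi]
  · simp

/-- An analytic solution of `4 s u' + 10 u = 1 + 4 s u²` near `0` has nonnegative derivatives. -/
theorem iteratedDeriv_nonneg_of_riccati {u : ℝ → ℝ} (hu : AnalyticAt ℝ u 0)
    (h : ∀ᶠ s in 𝓝 (0 : ℝ), 4 * (s * deriv u s) + 10 * u s = 1 + 4 * (s * (u * u) s)) (n : ℕ) :
    0 ≤ iteratedDeriv n u 0 := by
  induction n using Nat.strong_induction_on with
  | _ n ih =>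
    cases n with
    | zero =>
      have := h.self_of_nhds
      simp at this
      simp; linarith
    | succ n =>
      -- Differentiating `n + 1` times at `0` leaves `(4(n+1) + 10) u⁽ⁿ⁺¹⁾ = 4(n+1) (u²)⁽ⁿ⁾`; the
      -- right side involves only derivatives of `u` of order at most `n`.
      have e := Filter.EventuallyEq.iteratedDeriv_eq (n := n + 1) h
      have a1 : AnalyticAt ℝ (fun s : ℝ => s * deriv u s) 0 := analyticAt_id.mul hu.deriv
      have a2 : AnalyticAt ℝ (fun s : ℝ => s * (u * u) s) 0 := analyticAt_id.mul (hu.mul hu)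
      rw [iteratedDeriv_fun_add (f := fun s => 4 * (s * deriv u s)) (g := fun s => 10 * u s)
        (analyticAt_const.mul a1).contDiffAt (analyticAt_const.mul hu).contDiffAt,
        iteratedDeriv_fun_add (f := fun _ => 1) (g := fun s => 4 * (s * (u * u) s))
        contDiffAt_const (analyticAt_const.mul a2).contDiffAt, iteratedDeriv_const_mul_field,
        iteratedDeriv_const_mul_field, iteratedDeriv_const_mul_field,
        iteratedDeriv_succ_id_mul_zero hu.deriv, iteratedDeriv_succ_id_mul_zero (hu.mul hu),
        iteratedDeriv_const, if_neg (Nat.succ_ne_zero n), ← iteratedDeriv_succ'] at e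
      have h2 := iteratedDeriv_mul_nonneg (n := n) hu hu (fun i hi => ih i (Nat.lt_succ_of_le hi))
        (fun i hi => ih i (Nat.lt_succ_of_le hi))
      have h3 : 0 ≤ 4 * (((n : ℝ) + 1) * iteratedDeriv n (u * u) 0) := by positivity
      have h4 : (4 * ((n : ℝ) + 1) + 10) * iteratedDeriv (n + 1) u 0 ≥ 0 := by linarith
      exact nonneg_of_mul_nonneg_right h4 (by positivity)

/-! ### Absolute monotonicity and the radius of convergence -/

theorem HasFPowerSeriesOnBall.exists_deriv {f : ℝ → ℝ} {p : FormalMultilinearSeries ℝ ℝ ℝ} {x : ℝ}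
    {r : ENNReal} (h : HasFPowerSeriesOnBall f p x r) :
    ∃ q : FormalMultilinearSeries ℝ ℝ ℝ, HasFPowerSeriesOnBall (deriv f) q x r :=
  ⟨_, (ContinuousLinearMap.apply ℝ ℝ (1 : ℝ)).comp_hasFPowerSeriesOnBall h.fderiv⟩

/-- An analytic function whose derivatives at `x` are nonnegative is nonnegative to the right of `x`
in the disc of convergence. -/
theorem HasFPowerSeriesOnBall.nonneg_of_iteratedDeriv_nonneg {f : ℝ → ℝ}
    {p : FormalMultilinearSeries ℝ ℝ ℝ} {x y : ℝ} {r : ENNReal} (h : HasFPowerSeriesOnBall f p x r)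
    (h0 : ∀ n, 0 ≤ iteratedDeriv n f x) (hxy : x ≤ y) (hy : y ∈ Metric.eball x r) : 0 ≤ f y := by
  have h1 := h.hasFPowerSeriesAt.analyticAt.hasFPowerSeriesAt
  rw [h.hasFPowerSeriesAt.eq_formalMultilinearSeries h1] at h
  refine (h.hasSum_sub hy).nonneg fun n => ?_
  rw [FormalMultilinearSeries.apply_eq_prod_smul_coeff, FormalMultilinearSeries.coeff_ofScalars]
  have := h0 n
  have : 0 ≤ y - x := sub_nonneg.2 hxy
  simp only [Finset.prod_const, smul_eq_mul]
  positivity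

/-- Nonnegativity of all derivatives at `0` propagates along an interval of analyticity. -/
theorem iteratedDeriv_nonneg_on_Ico {f : ℝ → ℝ} {T : ℝ} (hf : AnalyticOnNhd ℝ f (Ico 0 T))
    (h0 : ∀ n, 0 ≤ iteratedDeriv n f 0) {t : ℝ} (ht : t ∈ Ico 0 T) (n : ℕ) :
    0 ≤ iteratedDeriv n f t := by
  have hfn : ∀ n, ∀ x ∈ Ico 0 T, AnalyticAt ℝ (iteratedDeriv n f) x := fun n x hx => by
    rw [iteratedDeriv_eq_iterate]; exact (hf x hx).iterated_deriv n
  have hsub : Icc 0 t ⊆ Ico 0 T := fun x hx => ⟨hx.1, hx.2.trans_lt ht.2⟩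
  -- Continuous induction: `S` is relatively closed in `[0, t]`, and each of its points below `t`
  -- has a right neighbourhood contained in `S`.
  let S : Set ℝ := {x | ∀ n, 0 ≤ iteratedDeriv n f x}
  have hclosed : IsClosed (S ∩ Icc 0 t) := by
    have : S ∩ Icc 0 t = ⋂ n, Icc 0 t ∩ iteratedDeriv n f ⁻¹' Ici 0 := by
      ext x
      simp only [S, mem_inter_iff, mem_ofPred_eq, mem_iInter, mem_preimage, mem_Ici]
      exact ⟨fun h n => ⟨h.2, h.1 n⟩, fun h => ⟨fun n => (h n).2, (h 0).1⟩⟩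
    rw [this]
    refine isClosed_iInter fun n => ?_
    exact ContinuousOn.preimage_isClosed_of_isClosed
      (fun x hx => (hfn n x (hsub hx)).continuousAt.continuousWithinAt) isClosed_Icc isClosed_Ici
  have key : Icc 0 t ⊆ S := by
    refine hclosed.Icc_subset_of_forall_mem_nhdsWithin h0 ?_
    rintro x ⟨hxS, hx0, hxt⟩
    have hxT := hsub ⟨hx0, hxt.le⟩
    obtain ⟨r, hr⟩ := (hf x hxT).hasFPowerSeriesAt
    -- All derivatives expand on the same ball of radius `r`, so one right neighbourhood of `x`
    -- serves every `n`.
    have hrn : ∀ n, ∃ q : FormalMultilinearSeries ℝ ℝ ℝ,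
        HasFPowerSeriesOnBall (iteratedDeriv n f) q x r := by
      intro n
      induction n with
      | zero => exact ⟨_, by simpa using hr⟩
      | succ n ih =>
        rw [iteratedDeriv_succ]
        exact ih.choose_spec.exists_deriv
    filter_upwards [self_mem_nhdsWithin,
      mem_nhdsWithin_of_mem_nhds (Metric.eball_mem_nhds x hr.r_pos)] with y hxy hy n
    obtain ⟨q, hq⟩ := hrn n
    refine hq.nonneg_of_iteratedDeriv_nonneg (fun m => ?_) (le_of_lt hxy) hy
    have := hxS (m + n)
    rwa [iteratedDeriv_eq_iterate, Function.iterate_add_apply, ← iteratedDeriv_eq_iterate,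
      ← iteratedDeriv_eq_iterate] at this
  exact key ⟨ht.1, le_rfl⟩ n

/-- A Taylor coefficient estimate for absolutely monotone analytic functions. -/
theorem iteratedDeriv_div_factorial_mul_pow_le {f : ℝ → ℝ} {T : ℝ}
    (hf : AnalyticOnNhd ℝ f (Ico 0 T)) (h0 : ∀ n, 0 ≤ iteratedDeriv n f 0) {t : ℝ}
    (ht : t ∈ Ioo 0 T) (n : ℕ) : iteratedDeriv n f 0 / n.factorial * t ^ n ≤ f t := by
  have hsub : uIcc 0 t ⊆ Ico 0 T := by
    rw [uIcc_of_le ht.1.le]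
    exact fun x hx => ⟨hx.1, hx.2.trans_lt ht.2⟩
  -- The Lagrange remainder is nonnegative, so `f t` dominates the Taylor polynomial and hence each
  -- single term of it.
  obtain ⟨y, hy, hyf⟩ := taylor_mean_remainder_lagrange_iteratedDeriv (n := n) ht.1.ne
    (fun x hx => (hf x (hsub hx)).contDiffAt.contDiffWithinAt)
  have hy0 := iteratedDeriv_nonneg_on_Ico hf h0 (hsub (Ioo_subset_Icc_self hy)) (n + 1)
  have ht0 : 0 ≤ t := ht.1.le
  have h2 : 0 ≤ f t - taylorWithinEval f n (uIcc 0 t) 0 t := by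
    rw [hyf, sub_zero]; positivity
  have h3 : ∀ k, iteratedDerivWithin k f (uIcc 0 t) 0 = iteratedDeriv k f 0 := fun k =>
    iteratedDerivWithin_eq_iteratedDeriv (uniqueDiffOn_uIcc ht.1.ne)
      (hf 0 (hsub left_mem_uIcc)).contDiffAt left_mem_uIcc
  rw [taylor_within_apply] at h2
  simp only [h3, sub_zero, smul_eq_mul] at h2
  have h4 := Finset.single_le_sum
    (f := fun k => ((k.factorial : ℝ)⁻¹ * t ^ k) * iteratedDeriv k f 0)
    (fun k _ => by have := h0 k; positivity) (Finset.self_mem_range_succ n)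
  calc _ = ((n.factorial : ℝ)⁻¹ * t ^ n) * iteratedDeriv n f 0 := by ring
    _ ≤ _ := h4
    _ ≤ f t := by linarith

/-- The Taylor series at `0` of a function that is analytic on `[0, T)` and has nonnegative
derivatives at `0` has radius of convergence at least `T`. -/
theorem le_radius_of_iteratedDeriv_nonneg {f : ℝ → ℝ} {T : ℝ}
    (hf : AnalyticOnNhd ℝ f (Ico 0 T)) (h0 : ∀ n, 0 ≤ iteratedDeriv n f 0) :
    ENNReal.ofReal T ≤ (FormalMultilinearSeries.ofScalars ℂ
      (fun n => ((iteratedDeriv n f 0 / n.factorial : ℝ) : ℂ))).radius := by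
  refine ENNReal.le_of_forall_nnreal_lt fun r hr => ?_
  have hrT : (r : ℝ) < T := by
    rw [ENNReal.lt_ofReal_iff_toReal_lt ENNReal.coe_ne_top] at hr
    simpa using hr
  rcases eq_or_ne r 0 with rfl | hr0
  · simp
  refine FormalMultilinearSeries.le_radius_of_bound _ (f r) fun n => ?_
  have h1 := iteratedDeriv_div_factorial_mul_pow_le hf h0
    (t := r) ⟨by positivity, hrT⟩ n
  rw [FormalMultilinearSeries.ofScalars_norm, Complex.norm_real, Real.norm_of_nonneg]
  · exact h1
  · have := h0 n
    positivity

/-! ### The least positive root of `tan η = η` and the value of `ω₁` -/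

theorem hasDerivAt_sin_sub_mul_cos (x : ℝ) :
    HasDerivAt (fun x : ℝ => Real.sin x - x * Real.cos x) (x * Real.sin x) x := by
  convert! (Real.hasDerivAt_sin x).sub ((hasDerivAt_id x).mul (Real.hasDerivAt_cos x)) using 1
  simp

theorem sin_sub_mul_cos_pos {x : ℝ} (h0 : 0 < x) (hx : x ≤ Real.pi) :
    0 < Real.sin x - x * Real.cos x := by
  have hm : StrictMonoOn (fun x : ℝ => Real.sin x - x * Real.cos x) (Icc 0 Real.pi) := by
    refine strictMonoOn_of_deriv_pos (convex_Icc _ _)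
      (fun x _ => (hasDerivAt_sin_sub_mul_cos x).continuousAt.continuousWithinAt) fun x hx => ?_
    rw [interior_Icc] at hx
    rw [(hasDerivAt_sin_sub_mul_cos x).deriv]
    exact mul_pos hx.1 (Real.sin_pos_of_mem_Ioo hx)
  simpa using hm (left_mem_Icc.2 Real.pi_pos.le) ⟨h0.le, hx⟩ h0

theorem strictAntiOn_sin_sub_mul_cos :
    StrictAntiOn (fun x : ℝ => Real.sin x - x * Real.cos x) (Icc Real.pi (2 * Real.pi)) := by
  refine strictAntiOn_of_deriv_neg (convex_Icc _ _)
    (fun x _ => (hasDerivAt_sin_sub_mul_cos x).continuousAt.continuousWithinAt) fun x hx => ?_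
  rw [interior_Icc] at hx
  rw [(hasDerivAt_sin_sub_mul_cos x).deriv]
  refine mul_neg_of_pos_of_neg (Real.pi_pos.trans hx.1) ?_
  have := Real.sin_pos_of_pos_of_lt_pi (x := x - Real.pi) (by linarith [hx.1]) (by linarith [hx.2])
  rw [Real.sin_sub_pi] at this
  linarith

/-- The root lies slightly left of `3π/2`; measuring from there makes the argument small enough for
the Taylor bounds of sine and cosine. -/
theorem sin_sub_mul_cos_three_pi_div_two_sub (y : ℝ) :
    Real.sin (3 * Real.pi / 2 - y) - (3 * Real.pi / 2 - y) * Real.cos (3 * Real.pi / 2 - y)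
      = (3 * Real.pi / 2 - y) * Real.sin y - Real.cos y := by
  have h : 3 * Real.pi / 2 - y = (Real.pi / 2 - y) + Real.pi := by ring
  have hs : Real.sin (3 * Real.pi / 2 - y) = - Real.cos y := by
    rw [h, Real.sin_add_pi, Real.sin_pi_div_two_sub]
  have hc : Real.cos (3 * Real.pi / 2 - y) = - Real.sin y := by
    rw [h, Real.cos_add_pi, Real.cos_pi_div_two_sub]
  rw [hs, hc]; ring

theorem exists_root_sin_sub_mul_cos :
    ∃ η ∈ Ioo (3 * Real.pi / 2 - 0.224) (3 * Real.pi / 2 - 0.21),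
      Real.sin η - η * Real.cos η = 0 := by
  have hpi1 := Real.pi_gt_d4
  have hpi2 := Real.pi_lt_d4
  refine intermediate_value_Ioo' (f := fun x : ℝ => Real.sin x - x * Real.cos x) (by linarith)
    (fun x _ => (hasDerivAt_sin_sub_mul_cos x).continuousAt.continuousWithinAt) ⟨?_, ?_⟩
  · rw [sin_sub_mul_cos_three_pi_div_two_sub]
    have h1 := abs_le.1 (Real.sin_bound (x := 0.21) (by norm_num [abs_of_pos]))
    have h2 := abs_le.1 (Real.cos_bound (x := 0.21) (by norm_num [abs_of_pos]))
    norm_num [abs_of_pos] at h1 h2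
    norm_num
    nlinarith
  · rw [sin_sub_mul_cos_three_pi_div_two_sub]
    have h1 := abs_le.1 (Real.sin_bound (x := 0.224) (by norm_num [abs_of_pos]))
    have h2 := abs_le.1 (Real.cos_bound (x := 0.224) (by norm_num [abs_of_pos]))
    norm_num [abs_of_pos] at h1 h2
    norm_num
    nlinarith

theorem sin_sub_mul_cos_eq_zero_of_tan_eq {η : ℝ} (h0 : 0 < η) (h : Real.tan η = η) :
    Real.sin η - η * Real.cos η = 0 := by
  have hc : Real.cos η ≠ 0 := by
    intro hc
    rw [Real.tan_eq_sin_div_cos, hc, div_zero] at h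
    exact h0.ne h
  rw [Real.tan_eq_sin_div_cos, div_eq_iff hc] at h
  linarith

/-- `sin x - x cos x` has derivative `x sin x`: it is positive on `(0, π]` and strictly decreasing
on `[π, 2π]`, so the root found near `3π/2` is the first one. -/
theorem eta1_spec : IsLeast {η : ℝ | 0 < η ∧ Real.tan η = η} eta1 ∧
    eta1 ∈ Ioo (3 * Real.pi / 2 - 0.224) (3 * Real.pi / 2 - 0.21) ∧
    Real.sin eta1 - eta1 * Real.cos eta1 = 0 ∧
    ∀ x ∈ Ioo 0 eta1, 0 < Real.sin x - x * Real.cos x := by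
  obtain ⟨η, hη, hη0⟩ := exists_root_sin_sub_mul_cos
  have hpi1 := Real.pi_gt_d4
  have hpi2 := Real.pi_lt_d4
  have hηpos : 0 < η := by linarith [hη.1]
  have hpos : ∀ x ∈ Ioo 0 η, 0 < Real.sin x - x * Real.cos x := by
    intro x hx
    rcases le_total x Real.pi with h | h
    · exact sin_sub_mul_cos_pos hx.1 h
    · rw [← hη0]
      exact strictAntiOn_sin_sub_mul_cos ⟨h, by linarith [hx.2, hη.2]⟩
        ⟨by linarith [hη.1], by linarith [hη.2]⟩ hx.2
  have hleast : IsLeast {η : ℝ | 0 < η ∧ Real.tan η = η} η := by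
    refine ⟨⟨hηpos, ?_⟩, fun x hx => ?_⟩
    · have hc : Real.cos η ≠ 0 := by
        intro hc
        have := Real.sin_sq_add_cos_sq η
        rw [hc] at this hη0
        rw [show Real.sin η = 0 by linarith] at this
        norm_num at this
      rw [Real.tan_eq_sin_div_cos, div_eq_iff hc]
      linarith
    · by_contra! hlt
      exact (hpos x ⟨hx.1, hlt⟩).ne' (sin_sub_mul_cos_eq_zero_of_tan_eq hx.1 hx.2)
  have : eta1 = η := hleast.csInf_eq
  rw [this]
  exact ⟨hleast, hη, hη0, hpos⟩

theorem eta1_pos : 0 < eta1 := eta1_spec.1.1.1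

theorem omega1_eq_cos : omega1 = Real.cos eta1 := by
  rw [omega1, div_eq_iff eta1_pos.ne']
  linarith [eta1_spec.2.2.1]

/-- Since `ω₁ = cos η₁` and `sin η₁ = η₁ cos η₁`, one has `ω₁²(1 + η₁²) = 1` with `ω₁ < 0`, so the
enclosure of `η₁` yields one of `ω₁`. -/
theorem omega1_mem_Ioo : omega1 ∈ Ioo (-0.2175 : ℝ) (-0.2165) := by
  have hpi1 := Real.pi_gt_d4
  have hpi2 := Real.pi_lt_d4
  obtain ⟨-, ⟨h1, h2⟩, h0, -⟩ := eta1_spec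
  have hneg : omega1 < 0 := by
    rw [omega1_eq_cos]
    exact Real.cos_neg_of_pi_div_two_lt_of_lt (by linarith) (by linarith)
  have hsq : omega1 ^ 2 * (1 + eta1 ^ 2) = 1 := by
    rw [omega1_eq_cos]
    have := Real.sin_sq_add_cos_sq eta1
    rw [show Real.sin eta1 = eta1 * Real.cos eta1 by linarith] at this
    linarith
  have hl : (4.48825 : ℝ) ^ 2 < eta1 ^ 2 := by
    apply pow_lt_pow_left₀ <;> [linarith; norm_num; norm_num]
  have hu : eta1 ^ 2 < (4.5024 : ℝ) ^ 2 := by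
    apply pow_lt_pow_left₀ <;> [linarith; linarith; norm_num]
  constructor
  · by_contra! h
    nlinarith
  · by_contra! h
    nlinarith

/-! ### The entire function `g` and its differential equations -/

theorem differentiable_gFun : Differentiable ℂ gFun := by
  have hr : (FormalMultilinearSeries.ofScalars ℂ
      (fun n : ℕ => (((2 * n + 1).factorial : ℕ) : ℂ)⁻¹)).radius = ⊤ := by
    refine FormalMultilinearSeries.radius_eq_top_of_summable_norm _ fun r => ?_
    refine (gFun_hasSum r).summable.norm.congr fun n => ?_
    rw [FormalMultilinearSeries.ofScalars_norm, norm_div, norm_pow, norm_inv]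
    simp [div_eq_inv_mul]
  have h : HasFPowerSeriesOnBall gFun (FormalMultilinearSeries.ofScalars ℂ
      (fun n : ℕ => (((2 * n + 1).factorial : ℕ) : ℂ)⁻¹)) 0 ⊤ := by
    refine ⟨hr.ge, by simp, fun {y} _ => ?_⟩
    rw [zero_add]
    refine (gFun_hasSum y).congr_fun fun n => ?_
    simp [FormalMultilinearSeries.apply_eq_prod_smul_coeff, div_eq_mul_inv]
  intro z
  exact (h.analyticAt_of_mem (by simp)).differentiableAt

theorem gFun_zero : gFun 0 = 1 := by
  refine (gFun_hasSum 0).unique ?_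
  convert! hasSum_single (f := fun n : ℕ => (0 : ℂ) ^ n / (((2 * n + 1).factorial : ℕ) : ℂ)) 0 ?_
  · simp
  · intro n hn
    simp [hn]

theorem gFun_sq_mul (ξ : ℂ) : gFun (ξ ^ 2) * ξ = Complex.sinh ξ := by
  rcases eq_or_ne ξ 0 with rfl | h
  · simp
  · rw [gFun_sq ξ h, div_mul_cancel₀ _ h]

theorem differentiable_deriv_of_entire {f : ℂ → ℂ} (hf : Differentiable ℂ f) :
    Differentiable ℂ (deriv f) := fun z => (hf.analyticAt z).deriv.differentiableAt

theorem hasDerivAt_comp_sq {f : ℂ → ℂ} (hf : Differentiable ℂ f) (ξ : ℂ) :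
    HasDerivAt (fun ξ => f (ξ ^ 2)) (deriv f (ξ ^ 2) * (2 * ξ)) ξ := by
  have := (hf (ξ ^ 2)).hasDerivAt.comp ξ (hasDerivAt_pow 2 ξ)
  simpa [Function.comp_def] using! this

theorem deriv_gFun_sq (ξ : ℂ) :
    2 * ξ ^ 2 * deriv gFun (ξ ^ 2) + gFun (ξ ^ 2) = Complex.cosh ξ := by
  have h1 := (hasDerivAt_comp_sq differentiable_gFun ξ).mul (hasDerivAt_id ξ)
  have h2 : HasDerivAt (fun ξ => gFun (ξ ^ 2) * ξ) (Complex.cosh ξ) ξ := by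
    simp_rw [gFun_sq_mul]
    exact Complex.hasDerivAt_sinh ξ
  have := h1.unique h2
  simp only [id] at this
  linear_combination this

theorem gFun_ode (z : ℂ) : 4 * z * deriv (deriv gFun) z + 6 * deriv gFun z = gFun z := by
  have hd1 := differentiable_deriv_of_entire differentiable_gFun
  have hd2 := differentiable_deriv_of_entire hd1
  have hne : ∀ z : ℂ, z ≠ 0 → 4 * z * deriv (deriv gFun) z + 6 * deriv gFun z = gFun z := by
    intro z hz
    obtain ⟨ξ, rfl⟩ := IsAlgClosed.exists_pow_nat_eq z two_pos
    have hξ : ξ ≠ 0 := by rintro rfl; simp at hz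
    have h1 := (((hasDerivAt_pow 2 ξ).const_mul 2).mul (hasDerivAt_comp_sq hd1 ξ)).add
      (hasDerivAt_comp_sq differentiable_gFun ξ)
    have h2 : HasDerivAt (fun ξ => 2 * ξ ^ 2 * deriv gFun (ξ ^ 2) + gFun (ξ ^ 2))
        (Complex.sinh ξ) ξ := by
      simp_rw [deriv_gFun_sq]
      exact Complex.hasDerivAt_cosh ξ
    have := h1.unique h2
    rw [← gFun_sq_mul] at this
    refine mul_right_cancel₀ hξ ?_
    norm_num at this
    linear_combination this
  -- The substitution `z = ξ²` settles `z ≠ 0`; the origin follows by continuity and density.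
  have hcont : Continuous fun z => 4 * z * deriv (deriv gFun) z + 6 * deriv gFun z :=
    ((continuous_const.mul continuous_id).mul hd2.continuous).add
      (continuous_const.mul hd1.continuous)
  exact congrFun (hcont.ext_on (dense_compl_singleton (0 : ℂ)) differentiable_gFun.continuous
    fun z hz => hne z hz) z

theorem deriv_gFun_ode (z : ℂ) :
    4 * z * deriv (deriv (deriv gFun)) z + 10 * deriv (deriv gFun) z = deriv gFun z := by
  have hd1 := differentiable_deriv_of_entire differentiable_gFun
  have hd2 := differentiable_deriv_of_entire hd1
  have h1 := (((hasDerivAt_id z).const_mul 4).mul (hd2 z).hasDerivAt).add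
    ((hd1 z).hasDerivAt.const_mul 6)
  have h2 : HasDerivAt (fun z => 4 * z * deriv (deriv gFun) z + 6 * deriv gFun z)
      (deriv gFun z) z := by
    simp_rw [gFun_ode]
    exact (differentiable_gFun z).hasDerivAt
  have := h1.unique h2
  simp only [id] at this
  linear_combination this

/-! ### Restriction to the real line -/

/-- Entire functions that are real on the real line. -/
structure IsRealEntire (f : ℂ → ℂ) : Prop where
  differentiable : Differentiable ℂ f
  ofReal_re : ∀ x : ℝ, (((f x).re : ℝ) : ℂ) = f x

namespace IsRealEntire
variable {f : ℂ → ℂ} (hf : IsRealEntire f)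
include hf

theorem hasDerivAt_re (x : ℝ) : HasDerivAt (fun x : ℝ => (f x).re) (deriv f x).re x :=
  (hf.differentiable x).hasDerivAt.real_of_complex

theorem derivative : IsRealEntire (deriv f) := by
  refine ⟨differentiable_deriv_of_entire hf.differentiable, fun x => ?_⟩
  have h1 := (hf.hasDerivAt_re x).ofReal_comp
  have h2 := (hf.differentiable x).hasDerivAt.comp_ofReal
  simp_rw [hf.ofReal_re] at h1
  exact h1.unique h2

theorem analyticAt_re (x : ℝ) : AnalyticAt ℝ (fun x : ℝ => (f x).re) x := by
  have h := (hf.differentiable.analyticAt x).restrictScalars (𝕜 := ℝ)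
  exact (Complex.reCLM.analyticAt _).comp (h.comp (Complex.ofRealCLM.analyticAt x))

end IsRealEntire

theorem isRealEntire_gFun : IsRealEntire gFun := by
  refine ⟨differentiable_gFun, fun x => ?_⟩
  have h : gFun x = ((∑' n : ℕ, x ^ n / (((2 * n + 1).factorial : ℕ) : ℝ) : ℝ) : ℂ) := by
    rw [gFun, Complex.ofReal_tsum]
    push_cast
    rfl
  rw [h, Complex.ofReal_re]

/-- The restriction of `g` to the real line. -/
noncomputable def gReal (x : ℝ) : ℝ := (gFun x).re

/-- The derivative of `g` on the real line. -/
noncomputable def gReal1 (x : ℝ) : ℝ := (deriv gFun x).re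

/-- The second derivative of `g` on the real line. -/
noncomputable def gReal2 (x : ℝ) : ℝ := (deriv (deriv gFun) x).re

/-- The third derivative of `g` on the real line. -/
noncomputable def gReal3 (x : ℝ) : ℝ := (deriv (deriv (deriv gFun)) x).re

theorem ofReal_gReal (x : ℝ) : (gReal x : ℂ) = gFun x := isRealEntire_gFun.ofReal_re x

theorem ofReal_gReal1 (x : ℝ) : (gReal1 x : ℂ) = deriv gFun x := isRealEntire_gFun.derivative.ofReal_re x

theorem ofReal_gReal2 (x : ℝ) : (gReal2 x : ℂ) = deriv (deriv gFun) x :=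
  isRealEntire_gFun.derivative.derivative.ofReal_re x

theorem ofReal_gReal3 (x : ℝ) : (gReal3 x : ℂ) = deriv (deriv (deriv gFun)) x :=
  isRealEntire_gFun.derivative.derivative.derivative.ofReal_re x

theorem hasDerivAt_gReal (x : ℝ) : HasDerivAt gReal (gReal1 x) x := isRealEntire_gFun.hasDerivAt_re x

theorem hasDerivAt_gReal1 (x : ℝ) : HasDerivAt gReal1 (gReal2 x) x :=
  isRealEntire_gFun.derivative.hasDerivAt_re x

theorem hasDerivAt_gReal2 (x : ℝ) : HasDerivAt gReal2 (gReal3 x) x :=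
  isRealEntire_gFun.derivative.derivative.hasDerivAt_re x

theorem analyticAt_gReal (x : ℝ) : AnalyticAt ℝ gReal x := isRealEntire_gFun.analyticAt_re x

theorem analyticAt_gReal1 (x : ℝ) : AnalyticAt ℝ gReal1 x := isRealEntire_gFun.derivative.analyticAt_re x

theorem analyticAt_gReal2 (x : ℝ) : AnalyticAt ℝ gReal2 x :=
  isRealEntire_gFun.derivative.derivative.analyticAt_re x

theorem gReal_zero : gReal 0 = 1 := by
  have := ofReal_gReal 0
  rw [Complex.ofReal_zero, gFun_zero] at this
  exact_mod_cast this

theorem gReal_ode (x : ℝ) : 4 * x * gReal2 x + 6 * gReal1 x = gReal x := by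
  have := gFun_ode x
  rw [← ofReal_gReal, ← ofReal_gReal1, ← ofReal_gReal2] at this
  exact_mod_cast this

theorem gReal1_ode (x : ℝ) : 4 * x * gReal3 x + 10 * gReal2 x = gReal1 x := by
  have := deriv_gFun_ode x
  rw [← ofReal_gReal1, ← ofReal_gReal2, ← ofReal_gReal3] at this
  exact_mod_cast this

theorem gReal1_zero : gReal1 0 = 1 / 6 := by
  have := gReal_ode 0
  rw [gReal_zero] at this
  linarith

theorem gReal_neg_sq_mul (x : ℝ) : gReal (-x ^ 2) * x = Real.sin x := by
  have h := gFun_sq_mul (x * Complex.I)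
  rw [Complex.sinh_mul_I, mul_pow, Complex.I_sq, mul_neg_one] at h
  have e : -(x : ℂ) ^ 2 = ((-x ^ 2 : ℝ) : ℂ) := by push_cast; ring
  rw [e, ← ofReal_gReal, ← Complex.ofReal_sin, ← mul_assoc] at h
  exact_mod_cast mul_right_cancel₀ Complex.I_ne_zero h

theorem gReal1_neg_sq_mul (x : ℝ) :
    2 * x ^ 3 * gReal1 (-x ^ 2) = Real.sin x - x * Real.cos x := by
  have h := deriv_gFun_sq (x * Complex.I)
  rw [Complex.cosh_mul_I, mul_pow, Complex.I_sq, mul_neg_one] at h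
  have e : -(x : ℂ) ^ 2 = ((-x ^ 2 : ℝ) : ℂ) := by push_cast; ring
  rw [e, ← ofReal_gReal, ← ofReal_gReal1, ← Complex.ofReal_cos] at h
  have h' : 2 * (-x ^ 2) * gReal1 (-x ^ 2) + gReal (-x ^ 2) = Real.cos x := by exact_mod_cast h
  rw [← gReal_neg_sq_mul, ← h']
  ring

theorem gReal_neg_eta1_sq : gReal (-eta1 ^ 2) = omega1 := by
  rw [omega1, eq_div_iff eta1_pos.ne', gReal_neg_sq_mul]

theorem gReal1_neg_eta1_sq : gReal1 (-eta1 ^ 2) = 0 := by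
  have h := gReal1_neg_sq_mul eta1
  rw [eta1_spec.2.2.1] at h
  have := eta1_pos
  exact (mul_eq_zero.1 h).resolve_left (by positivity)

/-- At `-η₁²` the differential equation reduces to `-4η₁² g'' = ω₁`, and `ω₁ < 0`. -/
theorem gReal2_neg_eta1_sq_pos : 0 < gReal2 (-eta1 ^ 2) := by
  have h := gReal_ode (-eta1 ^ 2)
  rw [gReal1_neg_eta1_sq, gReal_neg_eta1_sq] at h
  have h1 := omega1_mem_Ioo.2
  have h2 := eta1_pos
  by_contra! hle
  have : 0 ≤ 4 * -eta1 ^ 2 * gReal2 (-eta1 ^ 2) :=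
    mul_nonneg_of_nonpos_of_nonpos (by nlinarith) hle
  norm_num at h1
  linarith

theorem gReal1_pos {x : ℝ} (hx : x ∈ Ioc (-eta1 ^ 2) 0) : 0 < gReal1 x := by
  rcases hx.2.eq_or_lt with rfl | h0
  · rw [gReal1_zero]; norm_num
  · have hs : 0 < √(-x) := Real.sqrt_pos.2 (by linarith)
    have hsq : √(-x) ^ 2 = -x := Real.sq_sqrt (by linarith)
    have hlt : √(-x) < eta1 := (Real.sqrt_lt' eta1_pos).2 (by linarith [hx.1])
    have h := gReal1_neg_sq_mul (√(-x))
    have hp := eta1_spec.2.2.2 _ ⟨hs, hlt⟩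
    rw [← h, hsq, neg_neg] at hp
    exact pos_of_mul_pos_right hp (by positivity)

theorem strictMonoOn_gReal : StrictMonoOn gReal (Icc (-eta1 ^ 2) 0) := by
  refine strictMonoOn_of_deriv_pos (convex_Icc _ _)
    (fun x _ => (hasDerivAt_gReal x).continuousAt.continuousWithinAt) fun x hx => ?_
  rw [interior_Icc] at hx
  rw [(hasDerivAt_gReal x).deriv]
  exact gReal1_pos ⟨hx.1, hx.2.le⟩

/-! ### The real inverse and its nonnegative derivatives -/

/-- The global real inverse of a real analytic function with positive derivative on an interval is
analytic, with the expected derivative. -/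
theorem analyticAt_invFunOn_Ioo {f : ℝ → ℝ} {a b s : ℝ} (hf : ∀ x, AnalyticAt ℝ f x)
    (hpos : ∀ x ∈ Ioo a b, 0 < deriv f x) (hs : s ∈ Ioo a b) :
    Function.invFunOn f (Ioo a b) (f s) = s ∧
    AnalyticAt ℝ (Function.invFunOn f (Ioo a b)) (f s) ∧
    deriv (Function.invFunOn f (Ioo a b)) (f s) = (deriv f s)⁻¹ := by
  have hmono : StrictMonoOn f (Ioo a b) :=
    strictMonoOn_of_deriv_pos (convex_Ioo _ _)
      (fun x _ => (hf x).continuousAt.continuousWithinAt) (by rwa [interior_Ioo])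
  have hinv := hmono.injOn.leftInvOn_invFunOn
  have hne : deriv f s ≠ 0 := (hpos s hs).ne'
  have hstrict := (hf s).hasStrictDerivAt
  have hlinv : ∀ᶠ x in 𝓝 s, Function.invFunOn f (Ioo a b) (f x) = x := by
    filter_upwards [Ioo_mem_nhds hs.1 hs.2] with x hx using hinv hx
  refine ⟨hinv hs, ?_, (hstrict.to_local_left_inverse hne hlinv).hasDerivAt.deriv⟩
  refine ((hf s).analyticAt_localInverse hne).congr ?_
  rw [EventuallyEq, ← hstrict.map_nhds_eq hne, eventually_map]
  filter_upwards [hlinv, hstrict.eventually_left_inverse hne] with x h1 h2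
  rw [h1, h2]

/-- `1 - g(-s)` on the real line. -/
noncomputable def oneSubG (s : ℝ) : ℝ := 1 - gReal (-s)

theorem hasDerivAt_oneSubG (s : ℝ) : HasDerivAt oneSubG (gReal1 (-s)) s := by
  have := ((hasDerivAt_gReal (-s)).scomp s (hasDerivAt_neg s)).const_sub 1
  simpa [Function.comp_def] using! this

theorem analyticAt_oneSubG (s : ℝ) : AnalyticAt ℝ oneSubG s :=
  analyticAt_const.sub ((analyticAt_gReal (-s)).comp analyticAt_id.neg)

/-- The reciprocal `1 / g'(-s)` has nonnegative derivatives at `0`. -/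
theorem iteratedDeriv_inv_gReal1_neg_nonneg (n : ℕ) :
    0 ≤ iteratedDeriv n (fun s => (gReal1 (-s))⁻¹) 0 := by
  have hneg : AnalyticAt ℝ (fun s : ℝ => -s) 0 := analyticAt_id.neg
  have ha1 : AnalyticAt ℝ (fun s => gReal1 (-s)) 0 := (analyticAt_gReal1 (-0)).comp hneg
  have ha2 : AnalyticAt ℝ (fun s => gReal2 (-s)) 0 := (analyticAt_gReal2 (-0)).comp hneg
  have h10 : gReal1 (-0) ≠ 0 := by rw [neg_zero, gReal1_zero]; norm_num
  have hne : ∀ᶠ s in 𝓝 (0 : ℝ), gReal1 (-s) ≠ 0 := ha1.continuousAt.eventually_ne h10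
  have hd1 : ∀ s : ℝ, HasDerivAt (fun s => gReal1 (-s)) (-gReal2 (-s)) s := fun s => by
    simpa [Function.comp_def] using! (hasDerivAt_gReal1 (-s)).scomp s (hasDerivAt_neg s)
  have hd2 : ∀ s : ℝ, HasDerivAt (fun s => gReal2 (-s)) (-gReal3 (-s)) s := fun s => by
    simpa [Function.comp_def] using! (hasDerivAt_gReal2 (-s)).scomp s (hasDerivAt_neg s)
  have hu : AnalyticAt ℝ (fun s => gReal2 (-s) / gReal1 (-s)) 0 := ha2.div ha1 h10
  refine iteratedDeriv_nonneg_of_deriv_eq_mul (w := fun s => gReal2 (-s) / gReal1 (-s))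
    (ha1.inv h10) hu ?_ ?_ (iteratedDeriv_nonneg_of_riccati hu ?_) n
  · filter_upwards [hne] with s hs
    have := (hd1 s).inv hs
    rw [this.deriv]
    simp only [Pi.mul_apply, Pi.inv_apply]
    field_simp
  · simp [gReal1_zero]
  · filter_upwards [hne] with s hs
    have := (hd2 s).div (hd1 s) hs
    have e := this.deriv
    rw [show ((fun s => gReal2 (-s)) / fun s => gReal1 (-s))
      = fun s => gReal2 (-s) / gReal1 (-s) from rfl] at e
    rw [e]
    have ode := gReal1_ode (-s)
    simp only [Pi.mul_apply]
    field_simp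
    linear_combination gReal1 (-s) * ode

/-- A real function `k` on `[0, 1 - ω₁)` inverse to `s ↦ 1 - g(-s)`, analytic there, with
nonnegative derivatives at `0`. -/
theorem exists_real_inverse : ∃ k : ℝ → ℝ, AnalyticOnNhd ℝ k (Ico 0 (1 - omega1)) ∧
    (∀ n, 0 ≤ iteratedDeriv n k 0) ∧ k 0 = 0 ∧
    (∀ᶠ s in 𝓝 (0 : ℝ), k (oneSubG s) = s) ∧ ∀ᶠ t in 𝓝 (0 : ℝ), oneSubG (k t) = t := by
  have hd : deriv oneSubG = fun s => gReal1 (-s) := funext fun s => (hasDerivAt_oneSubG s).deriv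
  have h0 : oneSubG 0 = 0 := by simp [oneSubG, gReal_zero]
  have hsqpos : 0 < eta1 ^ 2 := pow_pos eta1_pos 2
  -- Extending the interval slightly left of `0` makes `0` an interior point, so that the inverse is
  -- analytic there too.
  obtain ⟨δ, hδ, hδpos⟩ : ∃ δ > 0, ∀ x ∈ Ioo (-δ) 0, 0 < gReal1 (-x) := by
    have hc : ContinuousAt (fun s : ℝ => gReal1 (-s)) 0 :=
      ((analyticAt_gReal1 (-0)).continuousAt).comp continuous_neg.continuousAt
    have : ∀ᶠ s in 𝓝 (0 : ℝ), 0 < gReal1 (-s) :=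
      hc.eventually_const_lt (by simp [gReal1_zero])
    obtain ⟨δ, hδ, h⟩ := Metric.eventually_nhds_iff.1 this
    refine ⟨δ, hδ, fun x hx => h ?_⟩
    rw [Real.dist_eq, sub_zero, abs_lt]
    exact ⟨hx.1, hx.2.trans hδ⟩
  have hpos : ∀ x ∈ Ioo (-δ) (eta1 ^ 2), 0 < deriv oneSubG x := by
    intro x hx
    rw [hd]
    rcases lt_or_ge x 0 with h | h
    · exact hδpos x ⟨hx.1, h⟩
    · exact gReal1_pos ⟨by linarith [hx.2], by linarith⟩
  have h0mem : (0 : ℝ) ∈ Ioo (-δ) (eta1 ^ 2) := ⟨by linarith, hsqpos⟩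
  have key := fun s (hs : s ∈ Ioo (-δ) (eta1 ^ 2)) =>
    analyticAt_invFunOn_Ioo analyticAt_oneSubG hpos hs
  set k := Function.invFunOn oneSubG (Ioo (-δ) (eta1 ^ 2))
  have hka : AnalyticAt ℝ k 0 := by simpa [h0] using (key 0 h0mem).2.1
  have hk0 : k 0 = 0 := by simpa [h0] using (key 0 h0mem).1
  have hleft : ∀ᶠ s in 𝓝 (0 : ℝ), k (oneSubG s) = s := by
    filter_upwards [Ioo_mem_nhds h0mem.1 h0mem.2] with s hs using (key s hs).1
  have hmap : map oneSubG (𝓝 0) = 𝓝 0 := by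
    have := (analyticAt_oneSubG 0).hasStrictDerivAt.map_nhds_eq (hpos 0 h0mem).ne'
    rwa [h0] at this
  refine ⟨k, ?_, ?_, hk0, hleft, ?_⟩
  · intro t ht
    have hcont : ContinuousOn oneSubG (Icc 0 (eta1 ^ 2)) :=
      fun x _ => (analyticAt_oneSubG x).continuousAt.continuousWithinAt
    have h1 : oneSubG (eta1 ^ 2) = 1 - omega1 := by rw [oneSubG, gReal_neg_eta1_sq]
    obtain ⟨s, hs, rfl⟩ := intermediate_value_Ico hsqpos.le hcont (by rwa [h0, h1])
    exact (key s ⟨by linarith [hs.1], hs.2⟩).2.1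
  · refine iteratedDeriv_nonneg_of_deriv_eq_comp (F := fun s => (gReal1 (-s))⁻¹) ?_ hka hk0 ?_
      iteratedDeriv_inv_gReal1_neg_nonneg
    · exact ((analyticAt_gReal1 (-0)).comp (f := fun s : ℝ => -s) analyticAt_id.neg).inv
        (by simp [gReal1_zero])
    · rw [EventuallyEq, ← hmap, eventually_map]
      filter_upwards [Ioo_mem_nhds h0mem.1 h0mem.2] with s hs
      rw [(key s hs).2.2, Function.comp_apply, (key s hs).1, hd]
  · rw [← hmap, eventually_map]
    filter_upwards [hleft] with s hs
    rw [hs]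

/-! ### The inverse branch on the complex disc -/

theorem one_sub_omega1_pos : 0 < 1 - omega1 := by
  have := omega1_mem_Ioo.2
  norm_num at this
  linarith

theorem gFun_mem_ball {s : ℝ} (hs : s ∈ Ioc (-eta1 ^ 2) 0) :
    gFun s ∈ Metric.ball (1 : ℂ) (1 - omega1) := by
  have hle : -eta1 ^ 2 ≤ 0 := hs.1.le.trans hs.2
  have h1 := strictMonoOn_gReal (left_mem_Icc.2 hle) ⟨hs.1.le, hs.2⟩ hs.1
  have h2 := strictMonoOn_gReal.monotoneOn ⟨hs.1.le, hs.2⟩ (right_mem_Icc.2 hle) hs.2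
  rw [gReal_neg_eta1_sq] at h1
  rw [gReal_zero] at h2
  rw [← ofReal_gReal, Metric.mem_ball, Complex.dist_eq, ← Complex.ofReal_one, ← Complex.ofReal_sub,
    Complex.norm_real, Real.norm_of_nonpos (by linarith)]
  linarith

/-- The principal inverse branch of `g` on the disc of radius `1 - ω₁` about `1`. -/
theorem exists_inverse_on_ball : ∃ h : ℂ → ℂ,
    AnalyticOnNhd ℂ h (Metric.ball (1 : ℂ) (1 - omega1)) ∧ h 1 = 0 ∧
    (∀ ω ∈ Metric.ball (1 : ℂ) (1 - omega1), gFun (h ω) = ω) ∧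
    ∀ s : ℝ, s ∈ Ioc (-eta1 ^ 2) 0 → h (gFun s) = s := by
  obtain ⟨k, hk, hk0, hkz, hleft, hright⟩ := exists_real_inverse
  have hT := one_sub_omega1_pos
  have hka : AnalyticAt ℝ k 0 := hk 0 ⟨le_rfl, hT⟩
  set c : ℕ → ℝ := fun n => iteratedDeriv n k 0 / n.factorial
  set p := FormalMultilinearSeries.ofScalars ℂ (fun n => (c n : ℂ))
  have hp : ENNReal.ofReal (1 - omega1) ≤ p.radius := le_radius_of_iteratedDeriv_nonneg hk hk0
  have hK : HasFPowerSeriesOnBall p.sum p 0 (ENNReal.ofReal (1 - omega1)) :=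
    (p.hasFPowerSeriesOnBall ((ENNReal.ofReal_pos.2 hT).trans_le hp)).mono
      (ENNReal.ofReal_pos.2 hT) hp
  have hKk : ∀ᶠ t : ℝ in 𝓝 0, p.sum (t : ℂ) = (k t : ℂ) := by
    have h1 := hka.hasFPowerSeriesAt.eventually_hasSum
    filter_upwards [h1] with t ht
    have ht' := Complex.hasSum_ofReal.2 ht
    rw [zero_add] at ht'
    rw [FormalMultilinearSeries.sum, ← ht'.tsum_eq]
    refine tsum_congr fun n => ?_
    simp [p, c, FormalMultilinearSeries.apply_eq_prod_smul_coeff]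
  have hmaps : ∀ ω ∈ Metric.ball (1 : ℂ) (1 - omega1),
      1 - ω ∈ Metric.eball (0 : ℂ) (ENNReal.ofReal (1 - omega1)) := by
    intro ω hω
    rw [Metric.eball_ofReal, mem_ball_zero_iff, norm_sub_rev]
    simpa [Complex.dist_eq] using hω
  have hhan : AnalyticOnNhd ℂ (fun ω => -p.sum (1 - ω)) (Metric.ball (1 : ℂ) (1 - omega1)) := by
    intro ω hω
    exact ((hK.analyticOnNhd _ (hmaps ω hω)).comp (f := fun ω : ℂ => 1 - ω)
      (analyticAt_const.sub analyticAt_id)).neg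
  have h1mem : (1 : ℂ) ∈ Metric.ball (1 : ℂ) (1 - omega1) := Metric.mem_ball_self hT
  have hpre : IsPreconnected (Metric.ball (1 : ℂ) (1 - omega1)) :=
    (convex_ball _ _).isPreconnected
  refine ⟨fun ω => -p.sum (1 - ω), hhan, ?_, ?_, ?_⟩
  · have := hKk.self_of_nhds
    simp only [Complex.ofReal_zero, hkz] at this
    simp [this]
  · have hg : AnalyticOnNhd ℂ (fun ω => gFun (-p.sum (1 - ω)))
        (Metric.ball (1 : ℂ) (1 - omega1)) := fun ω hω =>
      (differentiable_gFun.analyticAt _).comp (hhan ω hω)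
    -- The real points `1 - t`, where `p.sum` agrees with `k`, accumulate at `1`; the identity
    -- theorem carries `g ∘ h = id` to the whole disc.
    refine hg.eqOn_of_preconnected_of_frequently_eq analyticOnNhd_id hpre h1mem ?_
    have htend : Tendsto (fun t : ℝ => 1 - (t : ℂ)) (𝓝[≠] 0) (𝓝[≠] 1) := by
      refine tendsto_nhdsWithin_iff.2 ⟨?_, ?_⟩
      · have : Continuous fun t : ℝ => 1 - (t : ℂ) := by fun_prop
        simpa using (this.tendsto 0).mono_left nhdsWithin_le_nhds
      · filter_upwards [self_mem_nhdsWithin] with t ht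
        simpa using ht
    refine htend.frequently (Eventually.frequently ?_)
    filter_upwards [nhdsWithin_le_nhds hKk, nhdsWithin_le_nhds hright] with t h1 h2
    rw [sub_sub_cancel, h1, ← Complex.ofReal_neg, ← ofReal_gReal]
    rw [oneSubG] at h2
    rw [show gReal (-k t) = 1 - t by linarith]
    simp
  · have hle : -eta1 ^ 2 ≤ 0 := by have := sq_nonneg eta1; linarith
    have hlt : -eta1 ^ 2 < 0 := by have := eta1_pos; nlinarith
    -- The left-inverse property is known only near `0`; the real identity theorem continues it
    -- along the interval up to `-η₁²`.
    have ha : AnalyticOnNhd ℝ (fun s : ℝ => -p.sum (1 - gFun s)) (Ioc (-eta1 ^ 2) 0) := by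
      intro s hs
      have h1 := (hhan _ (gFun_mem_ball hs)).comp (differentiable_gFun.analyticAt (s : ℂ))
      exact (h1.restrictScalars (𝕜 := ℝ)).comp (Complex.ofRealCLM.analyticAt s)
    have hb : AnalyticOnNhd ℝ (fun s : ℝ => (s : ℂ)) (Ioc (-eta1 ^ 2) 0) :=
      fun s _ => Complex.ofRealCLM.analyticAt s
    refine ha.eqOn_of_preconnected_of_eventuallyEq hb isPreconnected_Ioc (right_mem_Ioc.2 hlt) ?_
    have hneg : Tendsto (fun s : ℝ => -s) (𝓝 0) (𝓝 0) := by
      simpa using continuous_neg.tendsto (0 : ℝ)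
    have hone : Tendsto oneSubG (𝓝 0) (𝓝 0) := by
      have := (analyticAt_oneSubG 0).continuousAt.tendsto
      rwa [show oneSubG 0 = 0 by simp [oneSubG, gReal_zero]] at this
    filter_upwards [hneg.eventually hleft, (hone.comp hneg).eventually hKk] with s h1 h2
    rw [Function.comp_apply, h1] at h2
    rw [← ofReal_gReal, show (1 : ℂ) - gReal s = (oneSubG (-s) : ℝ) by simp [oneSubG], h2]
    simp

/-! ### The square-root branch point -/

/-- Near `-η₁²` the function `g - ω₁` is the square of a local coordinate. -/
theorem exists_sqrt_coordinate : ∃ φ : ℂ → ℂ, AnalyticAt ℂ φ (-(eta1 : ℂ) ^ 2) ∧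
    φ (-(eta1 : ℂ) ^ 2) = 0 ∧ deriv φ (-(eta1 : ℂ) ^ 2) ≠ 0 ∧
    ∀ᶠ s : ℝ in 𝓝[>] (-eta1 ^ 2), (gFun s - omega1) ^ (1 / 2 : ℂ) = φ s := by
  set a : ℂ := -(eta1 : ℂ) ^ 2 with ha
  have haR : a = ((-eta1 ^ 2 : ℝ) : ℂ) := by push_cast; rfl
  have hga : gFun a = omega1 := by rw [haR, ← ofReal_gReal, gReal_neg_eta1_sq]
  have hg1a : deriv gFun a = 0 := by
    rw [haR, ← ofReal_gReal1, gReal1_neg_eta1_sq, Complex.ofReal_zero]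
  have hd1 : Differentiable ℂ (dslope gFun a) := by
    rw [← differentiableOn_univ, Complex.differentiableOn_dslope univ_mem, differentiableOn_univ]
    exact differentiable_gFun
  -- As `g'(a) = 0`, dividing out `z - a` twice gives `g = ω₁ + (z - a)² q` with `q a = g''(a)/2 >
  -- 0`; the coordinate is then `(z - a) q^{1/2}`.
  set q := dslope (dslope gFun a) a
  have hq : Differentiable ℂ q := by
    rw [← differentiableOn_univ, Complex.differentiableOn_dslope univ_mem, differentiableOn_univ]
    exact hd1
  have hgq : ∀ z, gFun z = omega1 + (z - a) ^ 2 * q z := by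
    intro z
    have h1 := sub_smul_dslope gFun a z
    have h2 := sub_smul_dslope (dslope gFun a) a z
    rw [dslope_same, hg1a, sub_zero] at h2
    rw [← h2, hga] at h1
    simp only [smul_eq_mul] at h1
    linear_combination -h1
  have hqa : q a = ((gReal2 (-eta1 ^ 2) / 2 : ℝ) : ℂ) := by
    have hg1 : deriv gFun = fun z => (z - a) * (2 * q z + (z - a) * deriv q z) := by
      funext z
      have hsub := (hasDerivAt_id z).sub_const a
      have := (((hsub.pow 2).mul (hq z).hasDerivAt).const_add (omega1 : ℂ)).deriv
      rw [show gFun = fun z => omega1 + (z - a) ^ 2 * q z from funext hgq]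
      refine Eq.trans this ?_
      simp
      ring
    have hr : Differentiable ℂ fun z => 2 * q z + (z - a) * deriv q z :=
      (hq.const_mul 2).add ((differentiable_id.sub_const a).mul (differentiable_deriv_of_entire hq))
    have h2 := (((hasDerivAt_id a).sub_const a).mul (hr a).hasDerivAt).deriv
    have h3 : deriv (deriv gFun) a = 2 * q a := by
      rw [hg1]
      refine Eq.trans h2 ?_
      simp
    rw [haR, ← ofReal_gReal2, ← haR] at h3
    push_cast
    rw [h3]
    ring
  have hpos := gReal2_neg_eta1_sq_pos
  have hslit : q a ∈ Complex.slitPlane := by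
    rw [hqa]
    exact Complex.ofReal_mem_slitPlane.2 (by positivity)
  have hr : AnalyticAt ℂ (fun z => q z ^ (1 / 2 : ℂ)) a :=
    (hq.analyticAt a).cpow analyticAt_const hslit
  have hra : 0 < (q a ^ (1 / 2 : ℂ)).re := by
    rw [hqa, show (1 / 2 : ℂ) = ((1 / 2 : ℝ) : ℂ) by push_cast; rfl,
      ← Complex.ofReal_cpow (by positivity), Complex.ofReal_re]
    positivity
  have hsub : AnalyticAt ℂ (fun z => z - a) a := analyticAt_id.sub analyticAt_const
  refine ⟨fun z => (z - a) * q z ^ (1 / 2 : ℂ), hsub.mul hr, by simp, ?_, ?_⟩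
  · have := (((hasDerivAt_id a).sub_const a).mul hr.differentiableAt.hasDerivAt).deriv
    have e : deriv (fun z => (z - a) * q z ^ (1 / 2 : ℂ)) a = q a ^ (1 / 2 : ℂ) := by
      refine Eq.trans this ?_
      simp
    rw [e]
    intro h0
    rw [h0] at hra
    simp at hra
  · have hcont : ContinuousAt (fun s : ℝ => (q s ^ (1 / 2 : ℂ)).re) (-eta1 ^ 2) := by
      refine Complex.continuous_re.continuousAt.comp ?_
      refine ContinuousAt.comp (g := fun z : ℂ => q z ^ (1 / 2 : ℂ)) ?_
        Complex.continuous_ofReal.continuousAt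
      rw [← haR]
      exact hr.continuousAt
    have hev : ∀ᶠ s : ℝ in 𝓝 (-eta1 ^ 2), 0 < (q s ^ (1 / 2 : ℂ)).re :=
      hcont.eventually_const_lt (by beta_reduce; rwa [← haR])
    filter_upwards [self_mem_nhdsWithin, nhdsWithin_le_nhds hev] with s hs hre
    have hs' : -eta1 ^ 2 < s := hs
    have hsa : (s : ℂ) - a = ((s + eta1 ^ 2 : ℝ) : ℂ) := by rw [haR]; push_cast; ring
    -- A positive real part makes this the principal root of its square; this is where `s > -η₁²` is
    -- needed.
    have hre' : 0 < (((s : ℂ) - a) * q s ^ (1 / 2 : ℂ)).re := by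
      rw [hsa, Complex.re_ofReal_mul]
      exact mul_pos (by linarith) hre
    have hsq : ((q s) ^ (1 / 2 : ℂ)) ^ 2 = q s := by
      rw [one_div]
      exact Complex.cpow_ofNat_inv_pow (q s) 2
    have : gFun s - omega1 = (((s : ℂ) - a) * q s ^ (1 / 2 : ℂ)) ^ 2 := by
      rw [hgq, mul_pow, hsq]
      ring
    rw [this]
    convert! Complex.sq_cpow_two_inv hre' using 2
    exact one_div 2

/-- The disc lies in the half-plane `Re ω > ω₁`, so the principal root of `ω - ω₁` is analytic on
all of it. -/
theorem sub_omega1_mem_slitPlane {ω : ℂ} (hω : ω ∈ Metric.ball (1 : ℂ) (1 - omega1)) :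
    ω - omega1 ∈ Complex.slitPlane := by
  left
  rw [Metric.mem_ball, Complex.dist_eq, norm_sub_rev] at hω
  have := (Complex.re_le_norm (1 - ω)).trans_lt hω
  simp at this ⊢
  linarith

theorem tendsto_gFun_ofReal : Tendsto (fun s : ℝ => gFun s) (𝓝 (-eta1 ^ 2)) (𝓝 (omega1 : ℂ)) := by
  have h : Continuous fun s : ℝ => gFun s :=
    differentiable_gFun.continuous.comp Complex.continuous_ofReal
  have := h.tendsto (-eta1 ^ 2)
  rwa [← ofReal_gReal, gReal_neg_eta1_sq] at this

theorem Ioc_mem_nhdsGT_neg_eta1_sq : Ioc (-eta1 ^ 2) 0 ∈ 𝓝[>] (-eta1 ^ 2) :=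
  Ioc_mem_nhdsGT (by have := eta1_pos; nlinarith)

/-- An inverse of `g` on the disc about `1` has a square-root branch point at `ω₁`. -/
theorem exists_branch_expansion {h : ℂ → ℂ}
    (hh : AnalyticOnNhd ℂ h (Metric.ball (1 : ℂ) (1 - omega1)))
    (hs : ∀ s : ℝ, s ∈ Ioc (-eta1 ^ 2) 0 → h (gFun s) = s) :
    ∃ ε : ℝ, 0 < ε ∧ ∃ ψ : ℂ → ℂ,
      AnalyticOnNhd ℂ ψ (Metric.ball (0 : ℂ) (Real.sqrt ε)) ∧
      ψ 0 = -(eta1 : ℂ) ^ 2 ∧ deriv ψ 0 ≠ 0 ∧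
      ∀ ω ∈ Metric.ball (1 : ℂ) (1 - omega1) ∩ Metric.ball (omega1 : ℂ) ε,
        h ω = ψ ((ω - (omega1 : ℂ)) ^ (1 / 2 : ℂ)) := by
  obtain ⟨φ, hφ, hφ0, hφ1, hev⟩ := exists_sqrt_coordinate
  have hst := hφ.hasStrictDerivAt
  set ψ := hst.localInverse φ _ _ hφ1
  have hψ : AnalyticAt ℂ ψ 0 := by
    have := hφ.analyticAt_localInverse hφ1
    rwa [hφ0] at this
  have hψ0 : ψ 0 = -(eta1 : ℂ) ^ 2 := by
    have := (hst.eventually_left_inverse hφ1).self_of_nhds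
    rwa [hφ0] at this
  obtain ⟨ρ, hρ, hρψ⟩ := Metric.eventually_nhds_iff.1 hψ.eventually_analyticAt
  have hψball : AnalyticOnNhd ℂ ψ (Metric.ball (0 : ℂ) ρ) := fun w hw => hρψ hw
  -- With `ε = ρ²`, `|ω - ω₁| < ε` puts the square root in the disc of radius `ρ` where `ψ` is
  -- analytic.
  refine ⟨ρ ^ 2, by positivity, ψ, by rwa [Real.sqrt_sq hρ.le], hψ0, ?_, ?_⟩
  · have := (hst.to_localInverse hφ1).hasDerivAt.deriv
    rw [hφ0] at this
    rw [this]
    exact inv_ne_zero hφ1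
  set U := Metric.ball (1 : ℂ) (1 - omega1) ∩ Metric.ball (omega1 : ℂ) (ρ ^ 2)
  have hUpre : IsPreconnected U := ((convex_ball _ _).inter (convex_ball _ _)).isPreconnected
  have hψU : AnalyticOnNhd ℂ (fun ω => ψ ((ω - (omega1 : ℂ)) ^ (1 / 2 : ℂ))) U := by
    intro ω hω
    have hroot : AnalyticAt ℂ (fun ω : ℂ => (ω - (omega1 : ℂ)) ^ (1 / 2 : ℂ)) ω :=
      (analyticAt_id.sub analyticAt_const).cpow analyticAt_const (sub_omega1_mem_slitPlane hω.1)
    refine AnalyticAt.comp (hψball _ ?_) hroot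
    have hsq : ((ω - (omega1 : ℂ)) ^ (1 / 2 : ℂ)) ^ 2 = ω - omega1 := by
      rw [one_div]
      exact Complex.cpow_ofNat_inv_pow _ 2
    have hlt := hω.2
    rw [Metric.mem_ball, Complex.dist_eq, ← hsq, norm_pow] at hlt
    rw [mem_ball_zero_iff]
    exact lt_of_pow_lt_pow_left₀ 2 hρ.le hlt
  have hgood : ∀ᶠ s : ℝ in 𝓝[>] (-eta1 ^ 2), gFun s ∈ U ∧ h (gFun s) = s ∧
      ψ ((gFun s - (omega1 : ℂ)) ^ (1 / 2 : ℂ)) = s := by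
    have h1 : ∀ᶠ s : ℝ in 𝓝 (-eta1 ^ 2), ψ (φ s) = s := by
      have h2 : Tendsto (fun s : ℝ => (s : ℂ)) (𝓝 (-eta1 ^ 2)) (𝓝 (-(eta1 : ℂ) ^ 2)) := by
        have := Complex.continuous_ofReal.tendsto (-eta1 ^ 2)
        push_cast at this
        exact this
      exact h2.eventually (hst.eventually_left_inverse hφ1)
    have h3 := tendsto_gFun_ofReal.eventually
      (Metric.ball_mem_nhds (omega1 : ℂ) (ε := ρ ^ 2) (by positivity))
    filter_upwards [hev, Ioc_mem_nhdsGT_neg_eta1_sq, nhdsWithin_le_nhds h1,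
      nhdsWithin_le_nhds h3] with s e1 e2 e3 e4
    exact ⟨⟨gFun_mem_ball e2, e4⟩, hs s e2, by rw [e1, e3]⟩
  -- The point `ω₁` is outside the disc, so the identity theorem is applied at `g(s₀)` for some `s₀
  -- > -η₁²` close by, around which the relations hold on both sides.
  obtain ⟨s₀, hs₀, hs₀'⟩ := ((eventually_eventually_nhdsWithin.2 hgood).and
    self_mem_nhdsWithin).exists
  rw [(isOpen_Ioi : IsOpen (Ioi (-eta1 ^ 2))).nhdsWithin_eq hs₀'] at hs₀
  obtain ⟨hs₀U, hs₀h, -⟩ := hs₀.self_of_nhds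
  refine (hh.mono inter_subset_left).eqOn_of_preconnected_of_frequently_eq hψU hUpre hs₀U ?_
  have htend : Tendsto (fun s : ℝ => gFun s) (𝓝[≠] s₀) (𝓝[≠] (gFun s₀)) := by
    refine tendsto_nhdsWithin_iff.2 ⟨?_, ?_⟩
    · have hc : Continuous fun s : ℝ => gFun s :=
        differentiable_gFun.continuous.comp Complex.continuous_ofReal
      exact (hc.tendsto s₀).mono_left nhdsWithin_le_nhds
    · filter_upwards [self_mem_nhdsWithin, nhdsWithin_le_nhds hs₀] with s hne hg heq
      have heq' : gFun s = gFun s₀ := heq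
      rw [heq', hs₀h] at hg
      exact hne (by exact_mod_cast hg.2.1.symm)
  refine htend.frequently (Eventually.frequently ?_)
  filter_upwards [nhdsWithin_le_nhds hs₀] with s hg
  rw [hg.2.1, hg.2.2]

/-! ### No analytic extension to `ω₁` -/

theorem omega1_mem_closure_ball :
    (omega1 : ℂ) ∈ closure (Metric.ball (1 : ℂ) (1 - omega1)) := by
  refine mem_closure_of_tendsto
    (tendsto_gFun_ofReal.mono_left (nhdsWithin_le_nhds (s := Ioi (-eta1 ^ 2)))) ?_
  filter_upwards [Ioc_mem_nhdsGT_neg_eta1_sq] with s hs using gFun_mem_ball hs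

/-- An inverse of `g` on the disc about `1` has no analytic extension to `ω₁`. -/
theorem not_exists_analytic_extension {h : ℂ → ℂ}
    (hg : ∀ ω ∈ Metric.ball (1 : ℂ) (1 - omega1), gFun (h ω) = ω)
    (hs : ∀ s : ℝ, s ∈ Ioc (-eta1 ^ 2) 0 → h (gFun s) = s) :
    ¬ ∃ H : ℂ → ℂ, AnalyticAt ℂ H (omega1 : ℂ) ∧
      ∀ᶠ ω in nhdsWithin (omega1 : ℂ) (Metric.ball (1 : ℂ) (1 - omega1)), H ω = h ω := by
  rintro ⟨H, hH, hHh⟩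
  have hB : ∀ᶠ s : ℝ in 𝓝[>] (-eta1 ^ 2), gFun s ∈ Metric.ball (1 : ℂ) (1 - omega1) := by
    filter_upwards [Ioc_mem_nhdsGT_neg_eta1_sq] with s hs using gFun_mem_ball hs
  have htend : Tendsto (fun s : ℝ => gFun s) (𝓝[>] (-eta1 ^ 2)) (𝓝 (omega1 : ℂ)) :=
    tendsto_gFun_ofReal.mono_left nhdsWithin_le_nhds
  have hHω : H omega1 = ((-eta1 ^ 2 : ℝ) : ℂ) := by
    refine tendsto_nhds_unique (hH.continuousAt.tendsto.comp htend) ?_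
    refine ((Complex.continuous_ofReal.tendsto (-eta1 ^ 2)).mono_left nhdsWithin_le_nhds).congr' ?_
    filter_upwards [(tendsto_nhdsWithin_iff.2 ⟨htend, hB⟩).eventually hHh,
      Ioc_mem_nhdsGT_neg_eta1_sq] with s h1 h2
    rw [Function.comp_apply, h1, hs s h2]
  have hnot : (omega1 : ℂ) ∉ Metric.ball (1 : ℂ) (1 - omega1) := fun hmem => by
    simpa using Complex.slitPlane_ne_zero (sub_omega1_mem_slitPlane hmem)
  have hne : (𝓝[Metric.ball (1 : ℂ) (1 - omega1)] (omega1 : ℂ)).NeBot :=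
    mem_closure_iff_nhdsWithin_neBot.1 omega1_mem_closure_ball
  have hcomp : AnalyticAt ℂ (fun ω => gFun (H ω)) omega1 :=
    (differentiable_gFun.analyticAt _).comp hH
  have hfreq : ∃ᶠ ω in 𝓝[≠] (omega1 : ℂ), gFun (H ω) = ω := by
    refine Frequently.filter_mono (Eventually.frequently (f := 𝓝[Metric.ball (1 : ℂ)
      (1 - omega1)] (omega1 : ℂ)) ?_) (nhdsWithin_mono _ fun ω hω => ?_)
    · filter_upwards [hHh, self_mem_nhdsWithin] with ω h1 h2
      rw [h1, hg ω h2]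
    · rintro rfl
      exact hnot hω
  -- The relation `g ∘ H = id` extends from the disc to a full neighbourhood of `ω₁`; its derivative
  -- there would be both `g'(-η₁²) H'(ω₁) = 0` and `1`.
  have hid : (fun ω => gFun (H ω)) =ᶠ[𝓝 (omega1 : ℂ)] id :=
    (hcomp.frequently_eq_iff_eventually_eq analyticAt_id).1 hfreq
  have hderiv : HasDerivAt (fun ω => gFun (H ω)) (deriv gFun (H omega1) * deriv H omega1) omega1 :=
    (differentiable_gFun _).hasDerivAt.comp _ hH.differentiableAt.hasDerivAt
  rw [hHω, ← ofReal_gReal1, gReal1_neg_eta1_sq, Complex.ofReal_zero, zero_mul] at hderiv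
  exact zero_ne_one (hderiv.unique ((hasDerivAt_id _).congr_of_eventuallyEq hid))

/-! ### The Taylor series at `1` and its exact radius -/

theorem hasSum_taylorCoeffAt {h : ℂ → ℂ} {c ω : ℂ} {r : ℝ}
    (hh : AnalyticOnNhd ℂ h (Metric.ball c r)) (hω : ω ∈ Metric.ball c r) :
    HasSum (fun n : ℕ => taylorCoeffAt h c n * (ω - c) ^ n) (h ω) := by
  refine (Complex.hasSum_taylorSeries_on_ball hh.differentiableOn hω).congr_fun fun n => ?_
  simp only [taylorCoeffAt, smul_eq_mul]
  ring

theorem le_radius_taylorCoeffAt {h : ℂ → ℂ} {c : ℂ} {r : ℝ}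
    (hh : AnalyticOnNhd ℂ h (Metric.ball c r)) :
    ENNReal.ofReal r ≤ (FormalMultilinearSeries.ofScalars ℂ (taylorCoeffAt h c)).radius := by
  refine ENNReal.le_of_forall_nnreal_lt fun ρ hρ => ?_
  have hρr : (ρ : ℝ) < r := by
    rw [ENNReal.lt_ofReal_iff_toReal_lt ENNReal.coe_ne_top] at hρ
    simpa using hρ
  have hsum := hasSum_taylorCoeffAt hh (ω := c + (ρ : ℝ)) (by simpa [Complex.dist_eq] using hρr)
  refine FormalMultilinearSeries.le_radius_of_tendsto _ (l := 0) ?_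
  refine (tendsto_zero_iff_norm_tendsto_zero.1 hsum.summable.tendsto_atTop_zero).congr fun n => ?_
  rw [FormalMultilinearSeries.ofScalars_norm]
  simp

/-- `ω₁` is at distance exactly `1 - ω₁` from `1`, so with a larger radius the sum of the series
would itself extend `h` analytically to `ω₁`. -/
theorem radius_taylorCoeffAt_le {h : ℂ → ℂ}
    (hh : AnalyticOnNhd ℂ h (Metric.ball (1 : ℂ) (1 - omega1)))
    (hno : ¬ ∃ H : ℂ → ℂ, AnalyticAt ℂ H (omega1 : ℂ) ∧
      ∀ᶠ ω in nhdsWithin (omega1 : ℂ) (Metric.ball (1 : ℂ) (1 - omega1)), H ω = h ω) :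
    (FormalMultilinearSeries.ofScalars ℂ (taylorCoeffAt h 1)).radius
      ≤ ENNReal.ofReal (1 - omega1) := by
  by_contra! hlt
  set p := FormalMultilinearSeries.ofScalars ℂ (taylorCoeffAt h 1)
  have hp := p.hasFPowerSeriesOnBall (lt_of_le_of_lt bot_le hlt)
  refine hno ⟨fun ω => p.sum (ω - 1), ?_, ?_⟩
  · refine AnalyticAt.comp (g := p.sum) (f := fun ω : ℂ => ω - 1) (hp.analyticOnNhd _ ?_)
      (analyticAt_id.sub analyticAt_const)
    rw [mem_eball_zero_iff]
    refine lt_of_eq_of_lt ?_ hlt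
    rw [← ofReal_norm, norm_sub_rev, ← Complex.ofReal_one, ← Complex.ofReal_sub, Complex.norm_real,
      Real.norm_of_nonneg one_sub_omega1_pos.le]
  · filter_upwards [self_mem_nhdsWithin] with ω hω
    rw [FormalMultilinearSeries.sum, ← (hasSum_taylorCoeffAt hh hω).tsum_eq]
    refine tsum_congr fun n => ?_
    simp [p, FormalMultilinearSeries.apply_eq_prod_smul_coeff, mul_comm]

theorem theorem2p1 :
    -- `η₁` really is the least positive root of `tan η = η`, and `ω₁ ≈ -0.217`
    IsLeast {η : ℝ | 0 < η ∧ Real.tan η = η} eta1 ∧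
    |omega1 - (-0.217)| < 0.0005 ∧
    ∃ h : ℂ → ℂ,
      -- `h` is an analytic right inverse of `g` on the disc
      AnalyticOnNhd ℂ h (Metric.ball (1 : ℂ) (1 - omega1)) ∧
      h 1 = 0 ∧
      (∀ ω ∈ Metric.ball (1 : ℂ) (1 - omega1), gFun (h ω) = ω) ∧
      -- the Taylor series of `h` at `1` represents `h` on the disc
      (∀ ω ∈ Metric.ball (1 : ℂ) (1 - omega1),
        HasSum (fun n : ℕ => taylorCoeffAt h 1 n * (ω - 1) ^ n) (h ω)) ∧
      -- and its radius of convergence is exactly `1 - ω₁`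
      (FormalMultilinearSeries.ofScalars ℂ (taylorCoeffAt h 1)).radius
        = ENNReal.ofReal (1 - omega1) ∧
      -- `ω₁` is a square-root branch point of `h`
      (∃ ε : ℝ, 0 < ε ∧ ∃ ψ : ℂ → ℂ,
        AnalyticOnNhd ℂ ψ (Metric.ball (0 : ℂ) (Real.sqrt ε)) ∧
        ψ 0 = -(eta1 : ℂ) ^ 2 ∧ deriv ψ 0 ≠ 0 ∧
        ∀ ω ∈ Metric.ball (1 : ℂ) (1 - omega1) ∩ Metric.ball (omega1 : ℂ) ε,
          h ω = ψ ((ω - (omega1 : ℂ)) ^ (1 / 2 : ℂ))) ∧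
      -- in particular `h` has no analytic extension to a neighbourhood of `ω₁`
      ¬ ∃ H : ℂ → ℂ, AnalyticAt ℂ H (omega1 : ℂ) ∧
        ∀ᶠ ω in nhdsWithin (omega1 : ℂ) (Metric.ball (1 : ℂ) (1 - omega1)), H ω = h ω := by
  obtain ⟨h, hh, h1, hg, hs⟩ := exists_inverse_on_ball
  have hno := not_exists_analytic_extension hg hs
  refine ⟨eta1_spec.1, ?_, h, hh, h1, hg, fun ω hω => hasSum_taylorCoeffAt hh hω,
    le_antisymm (radius_taylorCoeffAt_le hh hno) (le_radius_taylorCoeffAt hh),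
    exists_branch_expansion hh hs, hno⟩
  have := omega1_mem_Ioo
  rw [abs_lt]
  constructor <;> norm_num at this ⊢ <;> linarith
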